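/- **Conventions.** A scalar function $\mu:\mathbb R\to\mathbb R$ defines, for every $k$, the coordinatewise map $\mu:\mathbb R^k\to\mathbb R^k$, $\mu(x)=(\mu(x_1),\dots,\mu(x_k))$. A network $Net^\mu:\mathbb R^n\to\mathbb R^m$ is a map $$Net^\mu=\mu\circ A_L\circ\mu\circ A_{L-1}\circ\cdots\circ\mu\circ A_1,\qquad L\ge 1,$$ where $A_i:\mathbb R^{n_i}\to\mathbb R^{n_{i+1}}$, $A_i(x)=W_ix+b_i$, are affine maps, $n_1=n$ and $n_{L+1}=m$; its width is $\max\{n_1,\dots,n_L\}$. Two maps $f,g:X\to X$ of a topological space are *group homotopic from $f$ to $g$* if there is a continuous $H:X\times[0,1]\to X$ with $H(x,0)=f(x)$, $H(x,1)=g(x)$, and $H(x,t_1+t_2)=H(H(x,t_1),t_2)$ for all $x\in X$ and all $t_1,t_2\in[0,1]$ with $t_1+t_2\in[0,1]$. They are *group homotopic* if this holds from $f$ to $g$ or from $g$ to $f$. Let $A,B\subset\mathbb R^n$ be disjoint compact sets. They are *unlinked* if there are continuous maps $H:A\times[0,1]\to\mathbb R^n$ and $K:B\times[0,1]\to\mathbb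 R^n$ with $H(a,0)=a$, $K(b,0)=b$, with $H(A\times\{t\})\cap K(B\times\{t\})=\emptyset$ for all $t\in[0,1]$, and such that $H(A\times\{1\})$ and $K(B\times\{1\})$ lie in two disjoint closed balls; otherwise they are a *link pair*. A link pair has *nonzero degree* if the map $$\xi:A\times B\to S^{n-1},\qquad \xi(x,y)=\frac{x-y}{\|x-y\|},$$ has nonzero degree, that is, if $\xi_*:\widetilde H_{n-1}(A\times B;\mathbb Z)\to\widetilde H_{n-1}(S^{n-1};\mathbb Z)$ is not the zero homomorphism in reduced singular homology. (If $n\ge2$ and $A\times B$ is a closed connected oriented $(n-1)$-manifold, this says that the usual integer degree of $\xi$ is not $0$.) **Theorem 5.1.** Let $n>m$, let $\mu:\mathbb R\to\mathbb R$, and let $Net^\mu:\mathbb R^n\to\mathbb R^m$ be a network of width at most $n$ as above. Suppose that for each of the dimensions $k=n_2,\dots,n_{L+1}$ in which the activation map is used, $\mu:\mathbb R^k\to\mathbb R^k$ is group homotopic to a map $F:\mathbb R^k\to\mathbb R^k$ that is a homeomorphism onto its image $F(\mathbb R^k)$. Then $Net^\mu$ fails to classify any two compact sets $A,B\subset\mathbb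 R^n$ that form a link pair with nonzero degree: $$Net^\mu(A)\cap Net^\mu(B)\neq\emptyset.$$ -/

import Mathlib

open scoped unitInterval

noncomputable section

/-- Euclidean space `ℝᵏ`. -/
abbrev Euc (k : ℕ) : Type := EuclideanSpace ℝ (Fin k)

/-- The unit sphere `Sᵏ⁻¹` of `ℝᵏ`. -/
abbrev UnitSphere (k : ℕ) : Type := Metric.sphere (0 : Euc k) 1

/-! ### Group homotopies -/

/-- `GroupHomotopic f g`: there is a (jointly continuous) homotopy `H : X × [0,1] → X` with
`H(·,0) = f`, `H(·,1) = g`, and `H(x, s + t) = H(H(x, s), t)` whenever `s`, `t` and `s + t`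
lie in `[0,1]`. -/
def GroupHomotopic {X : Type*} [TopologicalSpace X] (f g : X → X) : Prop :=
  ∃ H : C(X × I, X),
    (∀ x, H (x, 0) = f x) ∧ (∀ x, H (x, 1) = g x) ∧
    ∀ r s t : I, (r : ℝ) = s + t → ∀ x, H (x, r) = H (H (x, s), t)

/-! ### Neural networks -/

/-- The map `ℝᵏ → ℝᵏ` that applies the scalar function `μ` to every coordinate. -/
def coordwise (μ : ℝ → ℝ) (k : ℕ) (x : Euc k) : Euc k :=
  WithLp.toLp 2 fun i => μ (x i)

/-- The affine map `x ↦ W x + b`. -/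
def affineLayer {n p : ℕ} (W : Matrix (Fin p) (Fin n) ℝ) (b : Euc p) (x : Euc n) : Euc p :=
  WithLp.toLp 2 fun i => W.mulVec x.ofLp i + b i

/-- The weights and biases of a feed-forward network with input space `ℝⁿ`, output space `ℝᵐ`
and at least one layer. `cons W b N` first applies the layer given by `W, b` and then `N`. -/
inductive Network : ℕ → ℕ → Type
  | single {n m : ℕ} (W : Matrix (Fin m) (Fin n) ℝ) (b : Euc m) : Network n m
  | cons {n p m : ℕ} (W : Matrix (Fin p) (Fin n) ℝ) (b : Euc p) (N : Network p m) : Network n m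

/-- The function computed by a network with activation `μ`, namely
`μ ∘ A_L ∘ ⋯ ∘ μ ∘ A_1`, where `A_1, …, A_L` are its affine maps. -/
def Network.eval (μ : ℝ → ℝ) : {n m : ℕ} → Network n m → Euc n → Euc m
  | _, m, .single W b => fun x => coordwise μ m (affineLayer W b x)
  | _, _, .cons (p := p) W b N => fun x => N.eval μ (coordwise μ p (affineLayer W b x))

/-- The width: the maximum of the dimensions of the domains of the layers
(the input dimension is counted, the output dimension is not). -/
def Network.width : {n m : ℕ} → Network n m → ℕ
  | n, _, .single _ _ => n
  | n, _, .cons _ _ N => max n N.width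

/-- The dimensions `k` for which the activation map `μ : ℝᵏ → ℝᵏ` is used in the network:
the target dimensions of its layers. -/
def Network.activationDims : {n m : ℕ} → Network n m → List ℕ
  | _, m, .single _ _ => [m]
  | _, _, .cons (p := p) _ _ N => p :: N.activationDims

/-! ### Link pairs -/

/-- `A` and `B` are unlinked: they can be deformed in `ℝⁿ`, staying disjoint from each other at
every time, until they lie in two disjoint compact balls. -/
def Unlinked {n : ℕ} (A B : Set (Euc n)) : Prop :=
  ∃ (H : C(A × I, Euc n)) (K : C(B × I, Euc n)),
    (∀ a : A, H (a, 0) = a) ∧ (∀ b : B, K (b, 0) = b) ∧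
    (∀ (t : I) (a : A) (b : B), H (a, t) ≠ K (b, t)) ∧
    ∃ (c c' : Euc n) (r r' : ℝ), 0 < r ∧ 0 < r' ∧
      Disjoint (Metric.closedBall c r) (Metric.closedBall c' r') ∧
      (∀ a : A, H (a, 1) ∈ Metric.closedBall c r) ∧
      (∀ b : B, K (b, 1) ∈ Metric.closedBall c' r')

/-- The map `ξ(x, y) = (x - y) / ‖x - y‖` from `A × B` to the unit sphere, for disjoint
`A` and `B`. -/
def linkMap {n : ℕ} (A B : Set (Euc n)) (hAB : Disjoint A B) : C(A × B, UnitSphere n) where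
  toFun q := ⟨‖(q.1 : Euc n) - q.2‖⁻¹ • ((q.1 : Euc n) - q.2), by
    have h : (q.1 : Euc n) - q.2 ≠ 0 := sub_ne_zero.2 (hAB.ne_of_mem q.1.2 q.2.2)
    rw [mem_sphere_zero_iff_norm, norm_smul, norm_inv, norm_norm,
      inv_mul_cancel₀ (norm_ne_zero_iff.2 h)]⟩
  continuous_toFun := by
    have hc : Continuous fun q : A × B => (q.1 : Euc n) - q.2 := by fun_prop
    refine Continuous.subtype_mk (Continuous.smul (Continuous.inv₀ hc.norm fun q => ?_) hc) _
    exact norm_ne_zero_iff.2 (sub_ne_zero.2 (hAB.ne_of_mem q.1.2 q.2.2))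

/-- Singular homology `H_k(X; ℤ)`. -/
abbrev SingularH (k : ℕ) (X : Type) [TopologicalSpace X] : ModuleCat.{0} ℤ :=
  ((AlgebraicTopology.singularHomologyFunctor (ModuleCat.{0} ℤ) k).obj
    (ModuleCat.of ℤ ℤ)).obj (TopCat.of X)

/-- The homomorphism `f_* : H_k(X; ℤ) → H_k(Y; ℤ)` induced by a continuous map `f`. -/
abbrev singularHMap (k : ℕ) {X Y : Type} [TopologicalSpace X] [TopologicalSpace Y] (f : C(X, Y)) :
    SingularH k X →ₗ[ℤ] SingularH k Y :=
  (((AlgebraicTopology.singularHomologyFunctor (ModuleCat.{0} ℤ) k).obj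
    (ModuleCat.of ℤ ℤ)).map (TopCat.ofHom f)).hom

/-- The reduced homology of `X`, as the kernel of `H_k(X; ℤ) → H_k(point; ℤ)`. -/
def reducedH (k : ℕ) (X : Type) [TopologicalSpace X] : Submodule ℤ (SingularH k X) :=
  LinearMap.ker (singularHMap k (ContinuousMap.const X PUnit.unit))

/-- A continuous map `ξ : X → Sⁿ⁻¹` has nonzero degree if the homomorphism that it induces
on the reduced integral homology in dimension `n - 1` is not zero. If `X` is a closed connected
oriented manifold of dimension `n - 1 ≥ 1`, that homomorphism sends the fundamental class of `X` to
`deg ξ` times that of the sphere, and both groups are infinite cyclic, so this says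
`deg ξ ≠ 0`. -/
def HasNonzeroDegree {n : ℕ} {X : Type} [TopologicalSpace X] (ξ : C(X, UnitSphere n)) : Prop :=
  ∃ α ∈ reducedH (n - 1) X, singularHMap (n - 1) ξ α ≠ 0

/-- `A` and `B` are a link pair with nonzero degree: they are disjoint and linked, and the map
`(x - y) / ‖x - y‖` on `A × B` has nonzero degree. -/
def LinkPairNonzeroDegree {n : ℕ} (A B : Set (Euc n)) : Prop :=
  ∃ hAB : Disjoint A B, ¬ Unlinked A B ∧ HasNonzeroDegree (linkMap A B hAB)

end

open CategoryTheory

noncomputable section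

/-! ### Singular homology -/

/-! Suppose the outputs on `A` and `B` are disjoint, and follow the normalized difference of the two
images, a map `A × B → Sⁿ⁻¹`, through the layers. Its degree stays nonzero. If an affine layer had a
nonzero kernel vector, the difference, which avoids the kernel, would deform to that vector without
vanishing, so the degree would be zero (`not_hasNonzeroDegree_of_mem_ker`). Hence each layer is
injective, and the width bound makes every layer but the last square and invertible. The activation
is the end of a homotopy from the identity that keeps the two images apart
(`exists_homotopy_of_groupHomotopic`). The last layer cannot be injective, since `m < n`. -/

lemma singularHMap_comp (k : ℕ) {X Y Z : Type} [TopologicalSpace X] [TopologicalSpace Y]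
    [TopologicalSpace Z] (g : C(Y, Z)) (f : C(X, Y)) (α : SingularH k X) :
    singularHMap k (g.comp f) α = singularHMap k g (singularHMap k f α) := by
  have h : TopCat.ofHom (g.comp f) = TopCat.ofHom f ≫ TopCat.ofHom g := rfl
  simp only [singularHMap, h, Functor.map_comp, ModuleCat.hom_comp, LinearMap.comp_apply]

lemma singularHMap_eq_of_homotopic (k : ℕ) {X Y : Type} [TopologicalSpace X]
    [TopologicalSpace Y] {f g : C(X, Y)} (h : f.Homotopic g) :
    singularHMap k f = singularHMap k g := by
  obtain ⟨H⟩ := h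
  let H' : TopCat.Homotopy (TopCat.ofHom f) (TopCat.ofHom g) := H
  exact congrArg ModuleCat.Hom.hom
    (H'.congr_homologyMap_singularChainComplexFunctor (ModuleCat.of ℤ ℤ) k)

lemma HasNonzeroDegree.of_homotopic {n : ℕ} {X : Type} [TopologicalSpace X]
    {ξ ζ : C(X, UnitSphere n)} (hξ : HasNonzeroDegree ξ) (h : ξ.Homotopic ζ) :
    HasNonzeroDegree ζ := by
  obtain ⟨α, hα, hne⟩ := hξ
  exact ⟨α, hα, singularHMap_eq_of_homotopic (n - 1) h ▸ hne⟩

lemma HasNonzeroDegree.of_comp {n : ℕ} {X : Type} [TopologicalSpace X]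
    {ψ : C(UnitSphere n, UnitSphere n)} {ξ : C(X, UnitSphere n)}
    (h : HasNonzeroDegree (ψ.comp ξ)) : HasNonzeroDegree ξ := by
  obtain ⟨α, hα, hne⟩ := h
  refine ⟨α, hα, fun h0 => hne ?_⟩
  rw [singularHMap_comp, h0, map_zero]

/-- A constant map factors through a point, where reduced classes die by definition. Reducedness
matters for `n = 1`, where the homology is in degree 0. -/
lemma not_hasNonzeroDegree_const {n : ℕ} {X : Type} [TopologicalSpace X] (e : UnitSphere n) :
    ¬ HasNonzeroDegree (ContinuousMap.const X e) := by
  rintro ⟨α, hα, hne⟩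
  apply hne
  have h : ContinuousMap.const X e =
      (ContinuousMap.const PUnit.{1} e).comp (ContinuousMap.const X PUnit.unit) := rfl
  rw [h, singularHMap_comp, LinearMap.mem_ker.1 hα, map_zero]

/-! ### Normalization of nowhere vanishing vector-valued maps -/

/-- The map `v / ‖v‖` to the unit sphere defined by a nowhere vanishing map `v`. -/
def normalizedMap {n : ℕ} {X : Type*} [TopologicalSpace X] (v : C(X, Euc n))
    (hv : ∀ x, v x ≠ 0) : C(X, UnitSphere n) where
  toFun x := ⟨‖v x‖⁻¹ • v x, by
    rw [mem_sphere_zero_iff_norm, norm_smul, norm_inv, norm_norm,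
      inv_mul_cancel₀ (norm_ne_zero_iff.2 (hv x))]⟩
  continuous_toFun := by
    have hc := v.continuous
    exact ((hc.norm.inv₀ fun x => norm_ne_zero_iff.2 (hv x)).smul hc).subtype_mk _

lemma normalizedMap_homotopic {n : ℕ} {X : Type*} [TopologicalSpace X] {v w : C(X, Euc n)}
    {hv : ∀ x, v x ≠ 0} {hw : ∀ x, w x ≠ 0} (H : v.Homotopy w) (hH : ∀ q, H q ≠ 0) :
    (normalizedMap v hv).Homotopic (normalizedMap w hw) :=
  ⟨{ toContinuousMap := normalizedMap H.toContinuousMap hH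
     map_zero_left := fun x => Subtype.ext (by simp [normalizedMap])
     map_one_left := fun x => Subtype.ext (by simp [normalizedMap]) }⟩

/-- A map that avoids a nontrivial kernel of a linear map has degree zero: the straight-line
homotopy to a nonzero vector of the kernel does not vanish. -/
lemma not_hasNonzeroDegree_of_mem_ker {n : ℕ} {X : Type} [TopologicalSpace X]
    {E : Type*} [AddCommGroup E] [Module ℝ E] {v : C(X, Euc n)} {hv : ∀ x, v x ≠ 0}
    (T : Euc n →ₗ[ℝ] E) (hT : ∀ x, T (v x) ≠ 0) {e : Euc n} (he : e ≠ 0) (hTe : T e = 0) :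
    ¬ HasNonzeroDegree (normalizedMap v hv) := by
  intro h
  let H : v.Homotopy (ContinuousMap.const X e) :=
    { toFun := fun q => (1 - (q.1 : ℝ)) • v q.2 + (q.1 : ℝ) • e
      continuous_toFun := by fun_prop
      map_zero_left := fun x => by simp
      map_one_left := fun x => by simp }
  have hH : ∀ q, H q ≠ 0 := by
    rintro ⟨t, x⟩ h0
    change (1 - (t : ℝ)) • v x + (t : ℝ) • e = 0 at h0
    -- Applying `T` removes the `e` term, so a zero can occur only at `t = 1`, where the value is
    -- `e`.
    have h1 : (1 - (t : ℝ)) • T (v x) = 0 := by simpa [hTe] using congrArg T h0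
    have ht : (t : ℝ) = 1 := by
      rcases smul_eq_zero.1 h1 with h2 | h2
      · linarith
      · exact absurd h2 (hT x)
    exact he (by simpa [ht] using h0)
  have hconst : normalizedMap (ContinuousMap.const X e) (fun _ => he) =
      ContinuousMap.const X (normalizedMap (ContinuousMap.const PUnit.{1} e) (fun _ => he) ⟨⟩) :=
    rfl
  exact not_hasNonzeroDegree_const _
    (hconst ▸ h.of_homotopic (normalizedMap_homotopic (hw := fun _ => he) H hH))

/-- Composing with an injective linear endomorphism preserves nonvanishing of the degree. -/
lemma HasNonzeroDegree.of_injective_comp {n : ℕ} {X : Type} [TopologicalSpace X]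
    {v w : C(X, Euc n)} {hv : ∀ x, v x ≠ 0} {hw : ∀ x, w x ≠ 0} (T : Euc n →ₗ[ℝ] Euc n)
    (hT : Function.Injective T) (hvw : ∀ x, w x = T (v x))
    (h : HasNonzeroDegree (normalizedMap v hv)) : HasNonzeroDegree (normalizedMap w hw) := by
  let S := LinearEquiv.ofInjectiveEndo T hT
  have hS : ∀ y, S.symm (T y) = y := fun y => S.symm_apply_apply y
  let ι : C(UnitSphere n, Euc n) :=
    ⟨fun u => S.symm u, S.symm.toLinearMap.continuous_of_finiteDimensional.comp
      continuous_subtype_val⟩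
  have hι : ∀ u, ι u ≠ 0 := fun u hu =>
    ne_zero_of_mem_unit_sphere u (S.symm.map_eq_zero_iff.1 hu)
  -- The normalized inverse of `T` recovers `v / ‖v‖` from `w / ‖w‖`, so the degree of the latter
  -- cannot vanish.
  refine HasNonzeroDegree.of_comp (ψ := normalizedMap ι hι) ?_
  convert h using 1
  ext1 x
  apply Subtype.ext
  have hpos : 0 < ‖w x‖ := norm_pos_iff.2 (hw x)
  have h1 : ι (normalizedMap w hw x) = ‖w x‖⁻¹ • v x := by
    change S.symm (‖w x‖⁻¹ • w x) = _
    rw [map_smul, hvw, hS]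
  change ‖ι (normalizedMap w hw x)‖⁻¹ • ι (normalizedMap w hw x) = ‖v x‖⁻¹ • v x
  rw [h1, norm_smul, norm_inv, norm_norm, smul_smul]
  congr 1
  field_simp

/-! ### Group homotopies -/

/-- An injective map that is group homotopic to `g` is the identity. -/
lemma GroupHomotopic.left_eq_id {X : Type*} [TopologicalSpace X] {f g : X → X}
    (h : GroupHomotopic f g) (hf : Function.Injective f) : f = id := by
  obtain ⟨H, h0, -, hadd⟩ := h
  funext x
  -- `0 = 0 + 0` makes `f` idempotent.
  have := hadd 0 0 0 (by simp) x
  rw [h0, h0] at this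
  exact (hf this).symm

/-- A map that is group homotopic to an injective map is the identity. -/
lemma GroupHomotopic.left_eq_id_of_right {X : Type*} [TopologicalSpace X] {f g : X → X}
    (h : GroupHomotopic f g) (hg : Function.Injective g) : f = id := by
  obtain ⟨H, h0, h1, hadd⟩ := h
  funext x
  -- `1 = 0 + 1` gives `g = g ∘ f`.
  have := hadd 1 0 1 (by simp) x
  rw [h0, h1, h1] at this
  exact (hg this).symm

/-- A map that is group homotopic, in one direction or the other, to an embedding is the time-one
map of a homotopy starting at the identity along which points with distinct final positions
never meet. -/
lemma exists_homotopy_of_groupHomotopic {X : Type*} [TopologicalSpace X] {F g : X → X}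
    (hF : Function.Injective F) (h : GroupHomotopic F g ∨ GroupHomotopic g F) :
    ∃ H : C(X × I, X), (∀ x, H (x, 0) = x) ∧ (∀ x, H (x, 1) = g x) ∧
      ∀ x y, g x ≠ g y → ∀ t, H (x, t) ≠ H (y, t) := by
  rcases h with h | h
  · have hid := h.left_eq_id hF
    obtain ⟨H, h0, h1, hadd⟩ := h
    refine ⟨H, fun x => by rw [h0, hid, id], h1, fun x y hxy t ht => hxy ?_⟩
    -- Paths that meet at time `t` flow together for the remaining time `1 - t` and end at the same
    -- point.
    have key := hadd 1 t (unitInterval.symm t) (by simp)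
    rw [← h1, ← h1, key, key, ht]
  · have hid := h.left_eq_id_of_right hF
    exact ⟨⟨Prod.fst, continuous_fst⟩, fun _ => rfl, fun x => by rw [hid]; rfl,
      fun x y hxy _ hxy' => hxy (congrArg g hxy')⟩

/-! ### Networks -/

lemma affineLayer_eq {n p : ℕ} (W : Matrix (Fin p) (Fin n) ℝ) (b : Euc p) (x : Euc n) :
    affineLayer W b x = Matrix.toEuclideanLin W x + b := rfl

lemma continuous_affineLayer {n p : ℕ} (W : Matrix (Fin p) (Fin n) ℝ) (b : Euc p) :
    Continuous (affineLayer W b) :=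
  (Matrix.toEuclideanLin W).continuous_of_finiteDimensional.add continuous_const

/-- The difference map `(x, y) ↦ f x - g y`. -/
def differenceMap {n : ℕ} {A B : Type} [TopologicalSpace A] [TopologicalSpace B]
    (f : C(A, Euc n)) (g : C(B, Euc n)) : C(A × B, Euc n) :=
  ⟨fun q => f q.1 - g q.2, by fun_prop⟩

/-- If the difference map of `f` and `g` has nonzero degree, then every affine layer that separates
the values of `f` from those of `g` is injective. -/
lemma injective_of_layer_ne {n p : ℕ} {A B : Type} [TopologicalSpace A] [TopologicalSpace B]
    {f : C(A, Euc n)} {g : C(B, Euc n)} {hfg : ∀ q, differenceMap f g q ≠ 0}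
    (hdeg : HasNonzeroDegree (normalizedMap (differenceMap f g) hfg))
    (W : Matrix (Fin p) (Fin n) ℝ) (b : Euc p)
    (hW : ∀ x y, affineLayer W b (f x) ≠ affineLayer W b (g y)) :
    Function.Injective (Matrix.toEuclideanLin W) := by
  refine (injective_iff_map_eq_zero _).2 fun e he => ?_
  by_contra hne
  refine not_hasNonzeroDegree_of_mem_ker (Matrix.toEuclideanLin W) (fun q hq => ?_) hne he hdeg
  apply hW q.1 q.2
  rw [affineLayer_eq, affineLayer_eq, sub_eq_zero.1 ((map_sub _ _ _).symm.trans hq)]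

/-- Maps `f`, `g` replace the sets so that `A × B`, which carries the homology class, stays fixed
while the induction changes the images. -/
theorem Network.exists_eval_eq {n m : ℕ} (N : Network n m) (hmn : m < n) (μ : ℝ → ℝ)
    (hμ : ∀ k ∈ N.activationDims, ∃ F : Euc k → Euc k, Topology.IsEmbedding F ∧
      (GroupHomotopic F (coordwise μ k) ∨ GroupHomotopic (coordwise μ k) F))
    (hwidth : N.width ≤ n) {A B : Type} [TopologicalSpace A] [TopologicalSpace B]
    (f : C(A, Euc n)) (g : C(B, Euc n)) (hfg : ∀ q, differenceMap f g q ≠ 0)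
    (hdeg : HasNonzeroDegree (normalizedMap (differenceMap f g) hfg)) :
    ∃ x y, N.eval μ (f x) = N.eval μ (g y) := by
  have finrank_le : ∀ {n p : ℕ} {W : Matrix (Fin p) (Fin n) ℝ},
      Function.Injective (Matrix.toEuclideanLin W) → n ≤ p := fun hW => by
    simpa using LinearMap.finrank_le_finrank_of_injective hW
  induction N with
  | single W b =>
    by_contra! hne
    exact absurd (finrank_le (injective_of_layer_ne hdeg W b fun x y h =>
      hne x y (congrArg (coordwise μ _) h))) (not_le.2 hmn)
  | @cons n p m W b N ih =>
    by_contra! hne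
    have hinj := injective_of_layer_ne hdeg W b fun x y h =>
      hne x y (congrArg (fun z => N.eval μ (coordwise μ p z)) h)
    -- `p` is the input dimension of the remaining network, so its width counts it.
    have hpw : p ≤ N.width := by cases N <;> simp [Network.width]
    obtain rfl : n = p :=
      le_antisymm (finrank_le hinj) (hpw.trans ((le_max_right _ _).trans hwidth))
    obtain ⟨F, hF, hFμ⟩ := hμ n (by simp [Network.activationDims])
    obtain ⟨H, H0, H1, Hne⟩ := exists_homotopy_of_groupHomotopic hF.injective hFμ
    let L : C(Euc n, Euc n) := ⟨affineLayer W b, continuous_affineLayer W b⟩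
    have hne' : ∀ x y, coordwise μ n (L (f x)) ≠ coordwise μ n (L (g y)) := fun x y h =>
      hne x y (congrArg (N.eval μ) h)
    -- This is the activation map; its continuity comes from `H`, not from `μ`.
    let M : C(Euc n, Euc n) := ⟨fun x => H (x, 1), by fun_prop⟩
    have hL : ∀ q, differenceMap (L.comp f) (L.comp g) q ≠ 0 := fun q hq =>
      hne' q.1 q.2 (congrArg (coordwise μ n) (sub_eq_zero.1 hq))
    have hM : ∀ q, differenceMap ((M.comp L).comp f) ((M.comp L).comp g) q ≠ 0 := fun q hq => by
      refine hne' q.1 q.2 ?_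
      rw [← H1, ← H1]
      exact sub_eq_zero.1 hq
    have hdegL : HasNonzeroDegree (normalizedMap (differenceMap (L.comp f) (L.comp g)) hL) := by
      refine hdeg.of_injective_comp (Matrix.toEuclideanLin W) hinj fun q => ?_
      change affineLayer W b (f q.1) - affineLayer W b (g q.2) = _
      rw [affineLayer_eq, affineLayer_eq, add_sub_add_right_eq_sub, ← map_sub]
      rfl
    let K : (differenceMap (L.comp f) (L.comp g)).Homotopy
        (differenceMap ((M.comp L).comp f) ((M.comp L).comp g)) :=
      { toFun := fun q => H (L (f q.2.1), q.1) - H (L (g q.2.2), q.1)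
        continuous_toFun := by fun_prop
        map_zero_left := fun q => by simp [H0, differenceMap]
        map_one_left := fun q => rfl }
    have hdegM := hdegL.of_homotopic (normalizedMap_homotopic (hw := hM) K fun q hq =>
      Hne _ _ (hne' q.2.1 q.2.2) q.1 (sub_eq_zero.1 hq))
    obtain ⟨x, y, hxy⟩ := ih hmn (fun k hk => hμ k (by simp [Network.activationDims, hk]))
      ((le_max_right _ _).trans hwidth) _ _ hM hdegM
    refine hne x y ?_
    change N.eval μ (H (L (f x), 1)) = N.eval μ (H (L (g y), 1)) at hxy
    rw [H1, H1] at hxy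
    exact hxy

end

theorem theorem5p1 {n m : ℕ} (hmn : m < n) (μ : ℝ → ℝ) (N : Network n m)
    (hμ : ∀ k ∈ N.activationDims, ∃ F : Euc k → Euc k, Topology.IsEmbedding F ∧
      (GroupHomotopic F (coordwise μ k) ∨ GroupHomotopic (coordwise μ k) F))
    (hwidth : N.width ≤ n)
    (A B : Set (Euc n)) (hA : IsCompact A) (hB : IsCompact B)
    (hlink : LinkPairNonzeroDegree A B) :
    (N.eval μ '' A ∩ N.eval μ '' B).Nonempty := by
  obtain ⟨hAB, -, hdeg⟩ := hlink
  -- By definition `linkMap` is the normalized difference of the two inclusions.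
  obtain ⟨x, y, hxy⟩ := N.exists_eval_eq hmn μ hμ hwidth
    (⟨Subtype.val, continuous_subtype_val⟩ : C(A, Euc n))
    (⟨Subtype.val, continuous_subtype_val⟩ : C(B, Euc n))
    (fun q => sub_ne_zero.2 (hAB.ne_of_mem q.1.2 q.2.2)) hdeg
  exact ⟨_, ⟨x, x.2, rfl⟩, ⟨y, y.2, hxy.symm⟩⟩
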